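/- Let $\mathbb H$ be the skew field of real quaternions with standard units $1,i,j,k$, identify $\mathbb C$ with $\mathbb R+\mathbb Ri\subset\mathbb H$, and let $\sigma\in\{1,i\}$. Two matrices $A,B\in\mathbb H^{n\times n}$ are called $\sigma$-consimilar if $B=(\sigma^{-1}S^{-1}\sigma)AS$ for some nonsingular $S\in\mathbb H^{n\times n}$; for $\sigma=1$ this is similarity, and for $\sigma=i$ it means $B=-iS^{-1}iAS$. For $\lambda\in\mathbb C$ and $k\ge 1$, let $J_k(\lambda)$ denote the $k\times k$ upper triangular Jordan block with eigenvalue $\lambda$, that is, with $\lambda$ on the diagonal, $1$ on the first superdiagonal and $0$ elsewhere. Then each square quaternion matrix $A$ is $\sigma$-consimilar to a complex matrix that is a direct sum, uniquely determined up to permutation of summands, of Jordan blocks $$J_k(a+bi),\qquad a,b\in\mathbb R,\qquad \begin{cases} b\ge 0 & \text{if }\sigma=1,\\ a\ge 0 & \text{if }\sigma=i.\end{cases}$$ -/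

import Mathlib

open scoped Quaternion

/-- The imaginary unit `i = 0 + 1i + 0j + 0k` of the real quaternions. -/
noncomputable def quatI : ℍ[ℝ] := Quaternion.coeComplex Complex.I

/-- `M ^ σ = σ⁻¹ M σ`: the automorphism `h ↦ σ⁻¹ h σ` of the quaternions applied entrywise. -/
noncomputable def conjBy {m n : ℕ} (σ : ℍ[ℝ]) (M : Matrix (Fin m) (Fin n) ℍ[ℝ]) :
    Matrix (Fin m) (Fin n) ℍ[ℝ] :=
  M.map fun h => σ⁻¹ * h * σ

/-- `B` is obtained from `A` by a `σ`-consimilarity transformation `A ↦ (σ⁻¹ S⁻¹ σ) A S`,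
where `S` is a nonsingular quaternion matrix. -/
def SigmaConsimilar {n : ℕ} (σ : ℍ[ℝ]) (A B : Matrix (Fin n) (Fin n) ℍ[ℝ]) : Prop :=
  ∃ S : (Matrix (Fin n) (Fin n) ℍ[ℝ])ˣ,
    conjBy σ ((S⁻¹ : (Matrix (Fin n) (Fin n) ℍ[ℝ])ˣ) : Matrix (Fin n) (Fin n) ℍ[ℝ]) * A *
      (S : Matrix (Fin n) (Fin n) ℍ[ℝ]) = B

/-- The `k × k` upper triangular Jordan block with eigenvalue `lam`. -/
noncomputable def jordanBlock (k : ℕ) (lam : ℂ) : Matrix (Fin k) (Fin k) ℂ :=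
  Matrix.of fun r c => if r = c then lam else if (r : ℕ) + 1 = (c : ℕ) then 1 else 0

/-- A finite sequence of (nonempty) Jordan blocks `J_{k₀}(λ₀), …, J_{k_{m-1}}(λ_{m-1})` of total
size `n`. -/
structure JordanData (n : ℕ) where
  /-- number of blocks -/
  m : ℕ
  /-- sizes of the blocks -/
  size : Fin m → ℕ
  /-- eigenvalues of the blocks -/
  eig : Fin m → ℂ
  size_pos : ∀ t, 0 < size t
  sum_size : ∑ t, size t = n

/-- The direct sum `J_{k₀}(λ₀) ⊕ ⋯ ⊕ J_{k_{m-1}}(λ_{m-1})`, a complex `n × n` matrix: the blocks are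
placed along the diagonal in the given order. -/
noncomputable def JordanData.toMatrix {n : ℕ} (J : JordanData n) : Matrix (Fin n) (Fin n) ℂ :=
  Matrix.reindex (finSigmaFinEquiv.trans (finCongr J.sum_size))
    (finSigmaFinEquiv.trans (finCongr J.sum_size))
    (Matrix.blockDiagonal' fun t => jordanBlock (J.size t) (J.eig t))

/-- `J` and `J'` consist of the same blocks up to a permutation. -/
def JordanData.IsPermOf {n : ℕ} (J J' : JordanData n) : Prop :=
  ∃ e : Fin J.m ≃ Fin J'.m, ∀ t, J'.size (e t) = J.size t ∧ J'.eig (e t) = J.eig t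

/-- The sign condition on the eigenvalues `a + bi`: `b ≥ 0` if `σ = 1`, and `a ≥ 0` if `σ = i`. -/
def JordanData.Normalized {n : ℕ} (σ : ℍ[ℝ]) (J : JordanData n) : Prop :=
  (σ = 1 → ∀ t, 0 ≤ (J.eig t).im) ∧ (σ = quatI → ∀ t, 0 ≤ (J.eig t).re)

/-- `J` is a `σ`-consimilarity canonical form of `A`: it is normalized, and `A` is
`σ`-consimilar to the complex matrix `J.toMatrix`, viewed as a quaternion matrix through the
embedding `a + bi ↦ a + bi` of `ℂ` into the quaternions. -/
def IsCanonicalForm {n : ℕ} (σ : ℍ[ℝ]) (A : Matrix (Fin n) (Fin n) ℍ[ℝ]) (J : JordanData n) :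
    Prop :=
  J.Normalized σ ∧ SigmaConsimilar σ A (J.toMatrix.map Quaternion.coeComplex)

/-! Multiplied by σ on the left, B = (σ⁻¹S⁻¹σ)AS becomes σB = S⁻¹(σA)S, so A and B are σ-consimilar
exactly when σA and σB are similar. As σ is complex it commutes with λ, and rescaling the i-th basis
vector of a block by σ^i turns σJ_k(λ) into J_k(σλ). Both sign conditions say Im(σλ) ≥ 0. What
remains is the Jordan form of a quaternion-linear map f, with eigenvalues in the closed upper half
plane.

Existence (`hasJordanBasis_quaternion`): f commutes with j, which acts conjugate-linearly, so an
eigenvector v for z yields jv for the conjugate z̄, and some eigenvalue has Im z ≥ 0. The map f - z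
is in general not quaternion-linear, but real polynomials in f are. The Fitting decomposition of f -
z (z real) or of (f - z)(f - z̄) therefore splits off a quaternionic summand, and induction on the
dimension handles the rest. For real z the summand is covered by the nilpotent case over a division
ring. Otherwise it is W ⊕ jW with W = ker (f - z)^n, and a complex Jordan basis of W is a
quaternionic one of the summand.

Uniqueness (`IsJordanBasis.exists_equiv`): over ℂ a chain for μ becomes two chains, for μ and its
conjugate. The ranks of (f - z)^k count complex chains, hence quaternionic ones, up to a factor 2
when z is real. -/

open Module

/-! ### Jordan bases over a division ring; the nilpotent case -/

section JordanBasis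

variable {K V : Type*} [DivisionRing K] [AddCommGroup V] [Module K V]

/-- A basis made of chains `b ⟨t, 0⟩, …, b ⟨t, s t - 1⟩`, each of which `f` maps by
`v ↦ μ t • v + (next vector of the chain)`. -/
def IsJordanBasis {ι : Type*} {s : ι → ℕ} (f : V →ₗ[K] V) (μ : ι → K)
    (b : Basis (Σ t, Fin (s t)) K V) : Prop :=
  ∀ t (i : ℕ) (hi : i < s t), f (b ⟨t, ⟨i, hi⟩⟩) =
    μ t • b ⟨t, ⟨i, hi⟩⟩ + if h : i + 1 < s t then b ⟨t, ⟨i + 1, h⟩⟩ else 0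

/-- `f` has a Jordan basis with nonempty chains and eigenvalues in `E`. -/
def HasJordanBasis (f : V →ₗ[K] V) (E : Set K) : Prop :=
  ∃ (ι : Type) (_ : Fintype ι) (s : ι → ℕ) (μ : ι → K) (b : Basis (Σ t, Fin (s t)) K V),
    (∀ t, 0 < s t) ∧ (∀ t, μ t ∈ E) ∧ IsJordanBasis f μ b

theorem HasJordanBasis.of_subsingleton [Subsingleton V] (f : V →ₗ[K] V) (E : Set K) :
    HasJordanBasis f E :=
  ⟨Empty, inferInstance, fun _ => 0, fun _ => 0, Basis.empty _, fun t => t.elim,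
    fun t => t.elim, fun t => t.elim⟩

theorem HasJordanBasis.mono {f : V →ₗ[K] V} {E E' : Set K} (h : HasJordanBasis f E)
    (hE : E ⊆ E') : HasJordanBasis f E' := by
  obtain ⟨ι, hι, s, μ, b, hs, hμ, hb⟩ := h
  exact ⟨ι, hι, s, μ, b, hs, fun t => hE (hμ t), hb⟩

/-- Jordan bases of complementary invariant subspaces combine to one of the whole space. -/
theorem HasJordanBasis.of_isCompl {f : V →ₗ[K] V} {E : Set K} {p q : Submodule K V}
    (hpq : IsCompl p q) {fp : p →ₗ[K] p} {fq : q →ₗ[K] q} (hfp : ∀ x, (fp x : V) = f x)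
    (hfq : ∀ x, (fq x : V) = f x) (hp : HasJordanBasis fp E) (hq : HasJordanBasis fq E) :
    HasJordanBasis f E := by
  obtain ⟨ι, _, s, μ, b, hs, hμ, hb⟩ := hp
  obtain ⟨ι', _, s', μ', b', hs', hμ', hb'⟩ := hq
  let B : Basis (Σ t, Fin (Sum.elim s s' t)) K V :=
    ((b.prod b').map (Submodule.prodEquivOfIsCompl p q hpq)).reindex
      (Equiv.sumSigmaDistrib fun t => Fin (Sum.elim s s' t)).symm
  have hl : ∀ t (i : Fin (s t)), B ⟨.inl t, i⟩ = b ⟨t, i⟩ := fun t i => by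
    simp [B, Equiv.sumSigmaDistrib]
  have hr : ∀ t (i : Fin (s' t)), B ⟨.inr t, i⟩ = b' ⟨t, i⟩ := fun t i => by
    simp [B, Equiv.sumSigmaDistrib]
  refine ⟨ι ⊕ ι', inferInstance, Sum.elim s s', Sum.elim μ μ', B, ?_, ?_, ?_⟩
  · rintro (t | t)
    exacts [hs t, hs' t]
  · rintro (t | t)
    exacts [hμ t, hμ' t]
  · rintro (t | t) i hi
    · change f (B ⟨.inl t, (⟨i, hi⟩ : Fin (s t))⟩) = μ t • B ⟨.inl t, (⟨i, hi⟩ : Fin (s t))⟩ +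
        if h : i + 1 < s t then B ⟨.inl t, (⟨i + 1, h⟩ : Fin (s t))⟩ else 0
      rw [hl, ← hfp, hb t i hi, Submodule.coe_add, Submodule.coe_smul]
      congr 1
      split_ifs
      · exact (hl t _).symm
      · rfl
    · change f (B ⟨.inr t, (⟨i, hi⟩ : Fin (s' t))⟩) = μ' t • B ⟨.inr t, (⟨i, hi⟩ : Fin (s' t))⟩ +
        if h : i + 1 < s' t then B ⟨.inr t, (⟨i + 1, h⟩ : Fin (s' t))⟩ else 0
      rw [hr, ← hfq, hb' t i hi, Submodule.coe_add, Submodule.coe_smul]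
      congr 1
      split_ifs
      · exact (hr t _).symm
      · rfl

/-- The vectors `v, N v, …, N ^ (k - 1) v` where `N ^ k = 0`, and a functional not vanishing on the
last one: the pairing matrix `φ (N ^ (i + j) v)` is nonsingular. -/
theorem eq_zero_of_forall_sum_mul_pow_eq_zero {N : End K V} {k : ℕ} (hk : N ^ k = 0) {v : V}
    {φ : V →ₗ[K] K} (hφ : φ ((N ^ (k - 1)) v) ≠ 0) (a : Fin k → K)
    (ha : ∀ j < k, φ ((N ^ j) (∑ i, a i • (N ^ (i : ℕ)) v)) = 0) : a = 0 := by
  have key : ∀ (i : ℕ) (hi : i < k), a ⟨i, hi⟩ = 0 := by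
    intro i
    induction i using Nat.strong_induction_on with
    | _ i ih =>
      intro hi
      -- Applying N^(k-1-i) kills the terms beyond i because N^k = 0; those before i vanish by
      -- induction. Only a_i φ(N^(k-1) v) survives.
      have h := ha (k - 1 - i) (by omega)
      rw [map_sum, map_sum, Finset.sum_eq_single ⟨i, hi⟩] at h
      · rw [map_smul, map_smul, ← Module.End.mul_apply, ← pow_add, smul_eq_mul] at h
        have : k - 1 - i + i = k - 1 := by omega
        simp only [this] at h
        exact (mul_eq_zero.1 h).resolve_right hφ
      · rintro ⟨i', hi'⟩ - hne
        rcases lt_trichotomy i' i with h' | h' | h'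
        · simp [ih i' h' hi']
        · exact absurd (Fin.ext h') hne
        · rw [map_smul, ← Module.End.mul_apply, ← pow_add,
            show k - 1 - i + i' = k + (k - 1 - i + i' - k) by omega, pow_add, hk]
          simp
      · simp
  exact funext fun i => key i i.2

/-- A nilpotent endomorphism over a division ring has a Jordan basis. -/
theorem hasJordanBasis_of_isNilpotent [FiniteDimensional K V] {N : End K V} (hN : IsNilpotent N) :
    HasJordanBasis N {0} := by
  induction hn : finrank K V using Nat.strong_induction_on generalizing V with
  | _ n ih =>
    rcases subsingleton_or_nontrivial V with hV | hV
    · exact .of_subsingleton _ _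
    set k := nilpotencyClass N with hkdef
    have hk : N ^ k = 0 := pow_nilpotencyClass hN
    have hkpos : 0 < k := pos_nilpotencyClass_iff.2 hN
    have hk1 : N ^ (k - 1) ≠ 0 := pow_pred_nilpotencyClass hN
    obtain ⟨v, hv⟩ : ∃ v, (N ^ (k - 1)) v ≠ 0 := by
      by_contra! h
      exact hk1 (LinearMap.ext h)
    obtain ⟨φ, hφ⟩ : ∃ φ : V →ₗ[K] K, φ ((N ^ (k - 1)) v) ≠ 0 := by
      by_contra! h
      exact hv ((Module.forall_dual_apply_eq_zero_iff K _).1 h)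
    have hpair := eq_zero_of_forall_sum_mul_pow_eq_zero hk hφ
    let c : Fin k → V := fun i => (N ^ (i : ℕ)) v
    have hc : LinearIndependent K c := by
      rw [Fintype.linearIndependent_iff]
      intro a ha i
      rw [hpair a fun j _ => by simp only [c] at ha; simp [ha]]
      rfl
    let C := Submodule.span K (Set.range c)
    -- The kernel of Φ is the complement of the chain: it is N-invariant since N^k = 0, and its k
    -- equations cost at most k dimensions, the number spanned by the chain.
    let Φ : V →ₗ[K] Fin k → K := LinearMap.pi fun j => φ ∘ₗ (N ^ (j : ℕ))
    have hdisj : Disjoint C (LinearMap.ker Φ) := by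
      rw [Submodule.disjoint_def]
      intro x hx hx'
      obtain ⟨a, rfl⟩ := (Submodule.mem_span_range_iff_exists_fun K).1 hx
      rw [hpair a fun j hj => congrFun (LinearMap.mem_ker.1 hx') ⟨j, hj⟩]
      simp
    have hCdim : finrank K C = k := by
      rw [finrank_span_eq_card hc, Fintype.card_fin]
    have hle := Submodule.finrank_add_finrank_le_of_disjoint hdisj
    have hrk := LinearMap.finrank_range_add_finrank_ker Φ
    have hrg : finrank K (LinearMap.range Φ) ≤ k := by
      simpa using Submodule.finrank_le (LinearMap.range Φ)
    have hcompl : IsCompl C (LinearMap.ker Φ) :=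
      (Submodule.isCompl_iff_disjoint _ _ (by omega)).2 hdisj
    have hNc : ∀ (i : ℕ) (hi : i < k), N (c ⟨i, hi⟩) = if h : i + 1 < k then c ⟨i + 1, h⟩ else 0 := by
      intro i hi
      have : N (c ⟨i, hi⟩) = (N ^ (i + 1)) v := by
        rw [pow_succ', Module.End.mul_apply]
      rw [this]
      split_ifs with h
      · rfl
      · rw [show i + 1 = k by omega, hk]; rfl
    have hNC : ∀ x ∈ C, N x ∈ C := by
      intro x hx
      refine Submodule.span_induction (p := fun x _ => N x ∈ C) ?_ (by simp)
        (fun x y _ _ hx hy => by rw [map_add]; exact add_mem hx hy)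
        (fun a x _ hx => by rw [map_smul]; exact C.smul_mem _ hx) hx
      rintro _ ⟨⟨i, hi⟩, rfl⟩
      rw [hNc i hi]
      split_ifs
      · exact Submodule.subset_span ⟨_, rfl⟩
      · exact zero_mem _
    have hNker : ∀ x ∈ LinearMap.ker Φ, N x ∈ LinearMap.ker Φ := by
      intro x hx
      rw [LinearMap.mem_ker] at hx ⊢
      ext ⟨j, hj⟩
      change φ ((N ^ j) (N x)) = 0
      rw [← Module.End.mul_apply, ← pow_succ]
      rcases Nat.lt_or_ge (j + 1) k with h | h
      · exact congrFun hx ⟨j + 1, h⟩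
      · rw [show j + 1 = k by omega, hk]; simp
    refine HasJordanBasis.of_isCompl hcompl (fp := N.restrict hNC) (fq := N.restrict hNker)
      (fun _ => rfl) (fun _ => rfl) ?_ ?_
    · refine ⟨Unit, inferInstance, fun _ => k, fun _ => 0,
        (Basis.span hc).reindex (Equiv.uniqueSigma fun _ : Unit => Fin k).symm,
        fun _ => hkpos, fun _ => rfl, ?_⟩
      intro t i hi
      apply Subtype.ext
      have hB : ∀ i, ((((Basis.span hc).reindex
          (Equiv.uniqueSigma fun _ : Unit => Fin k).symm) ⟨t, i⟩ : C) : V) = c i := by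
        intro i
        rw [Basis.reindex_apply, Basis.span_apply]
        rfl
      rw [LinearMap.coe_restrict_apply, hB, hNc, zero_smul, zero_add]
      split_ifs
      · exact (hB _).symm
      · rfl
    · refine ih _ ?_ ?_ rfl
      · omega
      · refine ⟨k, ?_⟩
        ext x
        rw [Module.End.pow_restrict k hNker]
        simp [hk]

end JordanBasis

/-! ### Quaternionic spaces as complex spaces with a conjugate-linear j; existence -/

section QuaternionicStructure

/-- The quaternions as a left complex vector space. -/
noncomputable instance Quaternion.instModuleComplex : Module ℂ ℍ[ℝ] :=
  Module.compHom ℍ[ℝ] Quaternion.ofComplex.toRingHom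

theorem Quaternion.complex_smul_def (z : ℂ) (q : ℍ[ℝ]) : z • q = (z : ℍ[ℝ]) * q := rfl

instance : IsScalarTower ℂ ℍ[ℝ] ℍ[ℝ] :=
  ⟨fun z p q => by simp only [Quaternion.complex_smul_def, smul_eq_mul, mul_assoc]⟩

/-- The imaginary unit `j`. -/
def quatJ : ℍ[ℝ] := ⟨0, 0, 1, 0⟩

@[simp] theorem re_quatJ : quatJ.re = 0 := rfl

@[simp] theorem imI_quatJ : quatJ.imI = 0 := rfl

@[simp] theorem imJ_quatJ : quatJ.imJ = 1 := rfl

@[simp] theorem imK_quatJ : quatJ.imK = 0 := rfl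

theorem quatJ_mul_self : quatJ * quatJ = -1 := by
  ext <;> simp

theorem quatJ_mul_coeComplex (z : ℂ) :
    quatJ * (z : ℍ[ℝ]) = ((starRingEnd ℂ z : ℂ) : ℍ[ℝ]) * quatJ := by
  ext <;> simp

theorem Quaternion.eq_coeComplex_add_quatJ_mul (q : ℍ[ℝ]) :
    q = ((⟨q.re, q.imI⟩ : ℂ) : ℍ[ℝ]) + quatJ * ((⟨q.imJ, -q.imK⟩ : ℂ) : ℍ[ℝ]) := by
  ext <;> simp

instance : Module.Finite ℂ ℍ[ℝ] := by
  refine ⟨Submodule.fg_def.2 ⟨{1, quatJ}, Set.toFinite _, eq_top_iff.2 fun q _ => ?_⟩⟩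
  rw [Quaternion.eq_coeComplex_add_quatJ_mul q, quatJ_mul_coeComplex]
  refine add_mem ?_ ?_
  · rw [← mul_one (Quaternion.coeComplex _), ← Quaternion.complex_smul_def]
    exact Submodule.smul_mem _ _ (Submodule.subset_span (by simp))
  · rw [← Quaternion.complex_smul_def]
    exact Submodule.smul_mem _ _ (Submodule.subset_span (by simp))

variable {V : Type*} [AddCommGroup V] [Module ℍ[ℝ] V]

/-- Multiplication by a real number, as a quaternion-linear map. -/
noncomputable def realScalar (V : Type*) [AddCommGroup V] [Module ℍ[ℝ] V] (a : ℝ) : End ℍ[ℝ] V where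
  toFun v := (a : ℍ[ℝ]) • v
  map_add' := smul_add _
  map_smul' q v := by
    rw [RingHom.id_apply, smul_smul, smul_smul, Quaternion.coe_commutes]

theorem realScalar_apply (a : ℝ) (v : V) : realScalar V a v = (a : ℍ[ℝ]) • v := rfl

theorem commute_realScalar (a : ℝ) (f : End ℍ[ℝ] V) : Commute (realScalar V a) f :=
  LinearMap.ext fun v => (map_smul f (a : ℍ[ℝ]) v).symm

theorem quatJ_smul_smul (v : V) : quatJ • quatJ • v = -v := by
  rw [smul_smul, quatJ_mul_self, neg_one_smul]

theorem hasJordanBasis_of_sub_realScalar_isNilpotent [Module.Finite ℍ[ℝ] V] {f : End ℍ[ℝ] V} {a : ℝ}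
    (hf : IsNilpotent (f - realScalar V a)) : HasJordanBasis f {(a : ℍ[ℝ])} := by
  obtain ⟨ι, _, s, μ, b, hs, hμ, hb⟩ := hasJordanBasis_of_isNilpotent hf
  refine ⟨ι, inferInstance, s, fun _ => a, b, hs, fun _ => rfl, fun t i hi => ?_⟩
  have h := hb t i hi
  rw [show μ t = 0 from hμ t, zero_smul, zero_add, LinearMap.sub_apply, sub_eq_iff_eq_add'] at h
  exact h

variable [Module ℂ V] [IsScalarTower ℂ ℍ[ℝ] V]

theorem coeComplex_smul (z : ℂ) (v : V) : (z : ℍ[ℝ]) • v = z • v := by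
  rw [← smul_one_smul ℍ[ℝ] z v, Quaternion.complex_smul_def, mul_one]

theorem quatJ_smul_complex_smul (z : ℂ) (v : V) :
    quatJ • z • v = (starRingEnd ℂ z : ℂ) • quatJ • v := by
  rw [← coeComplex_smul, ← coeComplex_smul, smul_smul, smul_smul, quatJ_mul_coeComplex]

theorem quaternion_smul_eq (q : ℍ[ℝ]) (v : V) :
    q • v = (⟨q.re, q.imI⟩ : ℂ) • v + quatJ • (⟨q.imJ, -q.imK⟩ : ℂ) • v := by
  conv_lhs => rw [Quaternion.eq_coeComplex_add_quatJ_mul q]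
  rw [add_smul, mul_smul, coeComplex_smul, coeComplex_smul]

/-- If `V = W ⊕ j W` for a complex subspace `W`, then a complex basis of `W` is a quaternionic
basis of `V`. -/
theorem exists_basis_of_complexForm {κ : Type*} [Fintype κ] {W : Submodule ℂ V}
    (hdisj : ∀ x ∈ W, quatJ • x ∈ W → x = 0) (hspan : ∀ v : V, ∃ x ∈ W, ∃ y ∈ W, v = x + quatJ • y)
    (b : Basis κ ℂ W) : ∃ B : Basis κ ℍ[ℝ] V, ∀ k, B k = b k := by
  have hli : LinearIndependent ℍ[ℝ] fun k => (b k : V) := by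
    rw [Fintype.linearIndependent_iff]
    intro q hq
    simp only [fun k => quaternion_smul_eq (q k) (b k : V), Finset.sum_add_distrib, ← Finset.smul_sum] at hq
    have hmem : ∀ a : κ → ℂ, ∑ k, a k • (b k : V) = ((∑ k, a k • b k : W) : V) := by simp
    rw [hmem, hmem fun k => (⟨(q k).imJ, -(q k).imK⟩ : ℂ)] at hq
    -- The relation reads x + jy = 0 with x, y in W, so jy = -x lies in W and y = 0.
    have hy := hdisj _ (Submodule.coe_mem _) (by
      rw [← neg_eq_iff_add_eq_zero.2 hq]
      exact W.neg_mem (Submodule.coe_mem _))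
    rw [hy, smul_zero, add_zero] at hq
    have hbi := Fintype.linearIndependent_iff.1 b.linearIndependent
    intro k
    have h1 := hbi _ (Subtype.ext hq) k
    have h2 := hbi _ (Subtype.ext hy) k
    rw [Complex.ext_iff] at h1 h2
    ext
    · exact h1.1
    · exact h1.2
    · exact h2.1
    · exact neg_eq_zero.1 h2.2
  have hW : ∀ x ∈ W, x ∈ Submodule.span ℍ[ℝ] (Set.range fun k => (b k : V)) := by
    intro x hx
    have h := congrArg (Subtype.val) (b.sum_repr ⟨x, hx⟩)
    simp only [Submodule.coe_sum, Submodule.coe_smul] at h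
    rw [← h]
    refine sum_mem fun k _ => ?_
    rw [← coeComplex_smul]
    exact Submodule.smul_mem _ _ (Submodule.subset_span ⟨k, rfl⟩)
  refine ⟨Basis.mk hli fun v _ => ?_, fun k => by rw [Basis.mk_apply]⟩
  obtain ⟨x, hx, y, hy, rfl⟩ := hspan v
  exact add_mem (hW x hx) (Submodule.smul_mem _ _ (hW y hy))

/-- Since f commutes with j and j is conjugate-linear, j exchanges the generalized eigenspaces of z
and its conjugate. -/
theorem quatJ_smul_pow_sub (f : End ℍ[ℝ] V) (z : ℂ) (n : ℕ) (x : V) :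
    ((f.restrictScalars ℂ - algebraMap ℂ (End ℂ V) (starRingEnd ℂ z)) ^ n) (quatJ • x) =
      quatJ • ((f.restrictScalars ℂ - algebraMap ℂ (End ℂ V) z) ^ n) x := by
  induction n generalizing x with
  | zero => simp
  | succ n ih =>
    rw [pow_succ, pow_succ, Module.End.mul_apply, Module.End.mul_apply, ← ih]
    congr 1
    simp [smul_sub, quatJ_smul_complex_smul]

/-- A real quadratic polynomial in `f` whose roots are `z` and its conjugate. -/
noncomputable def realQuadratic (f : End ℍ[ℝ] V) (z : ℂ) : End ℍ[ℝ] V :=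
  f * f - realScalar V (2 * z.re) * f + realScalar V (Complex.normSq z)

theorem realQuadratic_restrictScalars (f : End ℍ[ℝ] V) (z : ℂ) :
    (realQuadratic f z).restrictScalars ℂ =
      (f.restrictScalars ℂ - algebraMap ℂ (End ℂ V) z) *
        (f.restrictScalars ℂ - algebraMap ℂ (End ℂ V) (starRingEnd ℂ z)) := by
  ext x
  simp only [realQuadratic, LinearMap.coe_restrictScalars, LinearMap.add_apply, LinearMap.sub_apply,
    Module.End.mul_apply, realScalar_apply, Module.algebraMap_end_apply, map_sub, map_smul]
  rw [← Quaternion.coeComplex_coe, ← Quaternion.coeComplex_coe, coeComplex_smul, coeComplex_smul,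
    ← Complex.mul_conj, mul_smul, smul_sub, ← Complex.add_conj, add_smul, smul_comm z]
  abel_nf

theorem realQuadratic_pow_restrictScalars (f : End ℍ[ℝ] V) (z : ℂ) (n : ℕ) (x : V) :
    ((realQuadratic f z) ^ n) x =
      (((f.restrictScalars ℂ - algebraMap ℂ (End ℂ V) z) *
        (f.restrictScalars ℂ - algebraMap ℂ (End ℂ V) (starRingEnd ℂ z))) ^ n) x := by
  rw [← realQuadratic_restrictScalars]
  induction n generalizing x with
  | zero => simp
  | succ n ih => rw [pow_succ, pow_succ, Module.End.mul_apply, Module.End.mul_apply, ih]; rfl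

/-- For nonreal z the polynomials (X - z)^n and (X - z̄)^n are coprime, so V is the sum of their
kernels W and W'. As j exchanges these, V = W ⊕ jW, and the nilpotent map f - z on W supplies the
chains. -/
theorem hasJordanBasis_of_realQuadratic_pow_eq_zero [Module.Finite ℍ[ℝ] V] (f : End ℍ[ℝ] V)
    {z : ℂ} (hz : z.im ≠ 0) {n : ℕ} (hn : (realQuadratic f z) ^ n = 0) :
    HasJordanBasis f {(z : ℍ[ℝ])} := by
  have : Module.Finite ℂ V := Module.Finite.trans ℍ[ℝ] V
  set g : End ℂ V := f.restrictScalars ℂ with hg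
  have hzz : z ≠ starRingEnd ℂ z := fun h => hz (Complex.conj_eq_iff_im.1 h.symm)
  have hae : ∀ w : ℂ, Polynomial.aeval g ((Polynomial.X - Polynomial.C w) ^ n) =
      (g - algebraMap ℂ (End ℂ V) w) ^ n := by simp
  have hco : IsCoprime ((Polynomial.X - Polynomial.C z) ^ n)
      ((Polynomial.X - Polynomial.C (starRingEnd ℂ z)) ^ n) :=
    (Polynomial.isCoprime_X_sub_C_of_isUnit_sub (sub_ne_zero.2 hzz).isUnit).pow
  have hdisj := Polynomial.disjoint_ker_aeval_of_isCoprime g hco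
  have hsup := Polynomial.sup_ker_aeval_eq_ker_aeval_mul_of_coprime g hco
  have htop : LinearMap.ker (Polynomial.aeval g ((Polynomial.X - Polynomial.C z) ^ n *
      (Polynomial.X - Polynomial.C (starRingEnd ℂ z)) ^ n)) = ⊤ := by
    rw [← mul_pow, LinearMap.ker_eq_top]
    ext x
    simp only [map_pow, map_mul, map_sub, Polynomial.aeval_X, Polynomial.aeval_C]
    rw [← realQuadratic_pow_restrictScalars, hn]
    simp
  rw [htop] at hsup
  rw [hae, hae] at hsup hdisj
  set W := LinearMap.ker ((g - algebraMap ℂ (End ℂ V) z) ^ n) with hW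
  set W' := LinearMap.ker ((g - algebraMap ℂ (End ℂ V) (starRingEnd ℂ z)) ^ n) with hW'
  have hWW' : ∀ x ∈ W, quatJ • x ∈ W' := by
    intro x hx
    rw [hW', LinearMap.mem_ker, hg, quatJ_smul_pow_sub, LinearMap.mem_ker.1 hx, smul_zero]
  have hW'W : ∀ x ∈ W', quatJ • x ∈ W := by
    intro x hx
    have := quatJ_smul_pow_sub f (starRingEnd ℂ z) n x
    rw [Complex.conj_conj] at this
    rw [hW, LinearMap.mem_ker, hg, this, LinearMap.mem_ker.1 hx, smul_zero]
  have hinj : ∀ x ∈ W, quatJ • x ∈ W → x = 0 := by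
    intro x hx hx'
    have := Submodule.disjoint_def.1 hdisj _ hx' (hWW' x hx)
    have h2 := quatJ_smul_smul x
    rwa [this, smul_zero, eq_comm, neg_eq_zero] at h2
  have hspan : ∀ v : V, ∃ x ∈ W, ∃ y ∈ W, v = x + quatJ • y := by
    intro v
    obtain ⟨x, hx, y, hy, rfl⟩ := Submodule.mem_sup.1 (hsup ▸ Submodule.mem_top : v ∈ W ⊔ W')
    refine ⟨x, hx, -(quatJ • y), W.neg_mem (hW'W y hy), ?_⟩
    rw [smul_neg, quatJ_smul_smul, neg_neg]
  let N : End ℂ V := g - algebraMap ℂ (End ℂ V) z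
  have hNW : ∀ x ∈ W, N x ∈ W := by
    intro x hx
    rw [hW, LinearMap.mem_ker] at hx ⊢
    rw [← Module.End.mul_apply, ← pow_succ, pow_succ', Module.End.mul_apply, hx, map_zero]
  have hnil : IsNilpotent (N.restrict hNW) := by
    refine ⟨n, ?_⟩
    ext ⟨x, hx⟩
    rw [Module.End.pow_restrict n hNW]
    exact hx
  obtain ⟨ι, _, s, μ, b, hs, hμ, hb⟩ := hasJordanBasis_of_isNilpotent hnil
  obtain ⟨B, hB⟩ := exists_basis_of_complexForm hinj hspan b
  refine ⟨ι, inferInstance, s, fun _ => z, B, hs, fun _ => rfl, fun t i hi => ?_⟩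
  have h := congrArg Subtype.val (hb t i hi)
  rw [LinearMap.coe_restrict_apply, show μ t = 0 from hμ t, zero_smul, zero_add] at h
  rw [hB, coeComplex_smul, ← sub_eq_iff_eq_add']
  refine h.trans ?_
  split_ifs
  · exact (hB _).symm
  · rfl

theorem exists_eigenvalue_im_nonneg [Module.Finite ℍ[ℝ] V] [Nontrivial V] (f : End ℍ[ℝ] V) :
    ∃ z : ℂ, 0 ≤ z.im ∧ ∃ v : V, v ≠ 0 ∧ f v = z • v := by
  have : Module.Finite ℂ V := Module.Finite.trans ℍ[ℝ] V
  obtain ⟨z, hz⟩ := Module.End.exists_eigenvalue (f.restrictScalars ℂ : End ℂ V)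
  obtain ⟨v, hv⟩ := hz.exists_hasEigenvector
  have hfv : f v = z • v := hv.apply_eq_smul
  rcases le_total 0 z.im with h | h
  · exact ⟨z, h, v, hv.2, hfv⟩
  · refine ⟨starRingEnd ℂ z, by simpa using h, quatJ • v, ?_, ?_⟩
    · intro h0
      have h2 := quatJ_smul_smul v
      rw [h0, smul_zero, eq_comm, neg_eq_zero] at h2
      exact hv.2 h2
    · rw [map_smul, hfv, quatJ_smul_complex_smul]

/-- Splitting off the Fitting null component of an operator commuting with `f`. -/
theorem HasJordanBasis.of_fitting {K V : Type*} [DivisionRing K] [AddCommGroup V] [Module K V]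
    [FiniteDimensional K V] {f g : End K V} {E : Set K} (hgf : Commute g f)
    {v : V} (hv : v ≠ 0) (hgv : g v = 0)
    (hker : ∀ (n : ℕ) (h : ∀ x ∈ LinearMap.ker (g ^ n), f x ∈ LinearMap.ker (g ^ n)),
      HasJordanBasis (f.restrict h) E)
    (hrange : ∀ (p : Submodule K V) (h : ∀ x ∈ p, f x ∈ p), finrank K p < finrank K V →
      HasJordanBasis (f.restrict h) E) :
    HasJordanBasis f E := by
  -- n ≥ 1 puts v in ker g^n, which makes the range a proper subspace, as the induction needs.
  obtain ⟨n, hn, hn1⟩ := (g.eventually_isCompl_ker_pow_range_pow.and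
    (Filter.eventually_ge_atTop 1)).exists
  have hc : ∀ x, f ((g ^ n) x) = (g ^ n) (f x) := fun x =>
    (LinearMap.congr_fun (hgf.pow_left n).eq x).symm
  have h1 : ∀ x ∈ LinearMap.ker (g ^ n), f x ∈ LinearMap.ker (g ^ n) := fun x hx => by
    rw [LinearMap.mem_ker] at hx ⊢
    rw [← hc, hx, map_zero]
  have h2 : ∀ x ∈ LinearMap.range (g ^ n), f x ∈ LinearMap.range (g ^ n) := by
    rintro _ ⟨x, rfl⟩
    exact ⟨f x, (hc x).symm⟩
  refine .of_isCompl hn (fp := f.restrict h1) (fq := f.restrict h2) (fun _ => rfl) (fun _ => rfl)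
    (hker n h1) (hrange _ h2 ?_)
  have hvk : v ∈ LinearMap.ker (g ^ n) := by
    obtain ⟨m, rfl⟩ := Nat.exists_eq_add_of_le' hn1
    rw [LinearMap.mem_ker, pow_succ, Module.End.mul_apply, hgv, map_zero]
  refine Submodule.finrank_lt (fun htop => hv ?_)
  exact Submodule.disjoint_def.1 hn.disjoint v hvk (htop ▸ Submodule.mem_top)

/-- Every endomorphism of a finite-dimensional quaternionic vector space has a Jordan basis with
eigenvalues in the closed upper half plane. -/
theorem hasJordanBasis_quaternion [Module.Finite ℍ[ℝ] V] (f : End ℍ[ℝ] V) :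
    HasJordanBasis f (Quaternion.coeComplex '' {z | 0 ≤ z.im}) := by
  induction hn : finrank ℍ[ℝ] V using Nat.strong_induction_on generalizing V with
  | _ n ih =>
    rcases subsingleton_or_nontrivial V with hV | hV
    · exact .of_subsingleton _ _
    obtain ⟨z, hz, v, hv, hfv⟩ := exists_eigenvalue_im_nonneg f
    have hrange : ∀ (p : Submodule ℍ[ℝ] V) (h : ∀ x ∈ p, f x ∈ p),
        finrank ℍ[ℝ] p < finrank ℍ[ℝ] V →
        HasJordanBasis (f.restrict h) (Quaternion.coeComplex '' {z | 0 ≤ z.im}) :=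
      fun p h hp => ih _ (hn ▸ hp) _ rfl
    rcases hz.eq_or_lt with h0 | h0
    · have hzr : (z.re : ℂ) = z := Complex.ext rfl h0
      refine .of_fitting (g := f - realScalar V z.re)
        ((Commute.refl f).sub_left (commute_realScalar _ f)) hv ?_ ?_ hrange
      · rw [LinearMap.sub_apply, realScalar_apply, hfv, ← Quaternion.coeComplex_coe,
          coeComplex_smul, hzr, sub_self]
      · intro m h
        refine (hasJordanBasis_of_sub_realScalar_isNilpotent (a := z.re) ⟨m, ?_⟩).mono ?_
        · have hinv : ∀ x ∈ LinearMap.ker ((f - realScalar V z.re) ^ m),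
              (f - realScalar V z.re) x ∈ LinearMap.ker ((f - realScalar V z.re) ^ m) :=
            fun x hx => sub_mem (h x hx) (Submodule.smul_mem _ _ hx)
          have : f.restrict h - realScalar _ z.re = (f - realScalar V z.re).restrict hinv := rfl
          ext ⟨x, hx⟩
          rw [this, Module.End.pow_restrict m hinv]
          exact hx
        · rw [Set.singleton_subset_iff, ← Quaternion.coeComplex_coe, hzr]
          exact ⟨z, hz, rfl⟩
    · have hcomm : Commute (realQuadratic f z) f :=
        ((Commute.refl f).mul_left (Commute.refl f)).sub_left
          ((commute_realScalar _ f).mul_left (Commute.refl f)) |>.add_left (commute_realScalar _ f)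
      refine .of_fitting hcomm hv ?_ ?_ hrange
      · have h := realQuadratic_pow_restrictScalars f z 1 v
        rw [pow_one, pow_one] at h
        rw [h, ((Commute.refl (f.restrictScalars ℂ)).sub_left
          (Algebra.commute_algebraMap_left _ _)).sub_right
          (Algebra.commute_algebraMap_right _ _) |>.eq, Module.End.mul_apply]
        simp [hfv]
      · intro m h
        refine (hasJordanBasis_of_realQuadratic_pow_eq_zero (z := z) (n := m) _ h0.ne' ?_).mono
          (Set.singleton_subset_iff.2 ⟨z, hz, rfl⟩)
        have hinv : ∀ x ∈ LinearMap.ker (realQuadratic f z ^ m),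
            realQuadratic f z x ∈ LinearMap.ker (realQuadratic f z ^ m) :=
          fun x hx => add_mem (sub_mem (h _ (h x hx)) (Submodule.smul_mem _ _ (h x hx)))
            (Submodule.smul_mem _ _ hx)
        have : realQuadratic (f.restrict h) z = (realQuadratic f z).restrict hinv := rfl
        ext ⟨x, hx⟩
        rw [this, Module.End.pow_restrict m hinv]
        exact hx

end QuaternionicStructure

/-! ### Uniqueness: counting chains by ranks -/

section Counting

/-- On a chain for z the map f - z is the shift, so its k-th power loses the first k vectors; on any
other chain it is invertible. -/
theorem IsJordanBasis.range_pow {K V ι : Type*} [Field K] [AddCommGroup V] [Module K V]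
    {s : ι → ℕ} {f : End K V} {μ : ι → K} {b : Basis (Σ t, Fin (s t)) K V}
    (hb : IsJordanBasis f μ b) (z : K) (k : ℕ) :
    LinearMap.range ((f - algebraMap K (End K V) z) ^ k) =
      Submodule.span K (b '' {x | μ x.1 = z → k ≤ (x.2 : ℕ)}) := by
  set g := f - algebraMap K (End K V) z with hg
  have hgb : ∀ t (i : ℕ) (hi : i < s t), g (b ⟨t, ⟨i, hi⟩⟩) =
      (μ t - z) • b ⟨t, ⟨i, hi⟩⟩ + if h : i + 1 < s t then b ⟨t, ⟨i + 1, h⟩⟩ else 0 := by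
    intro t i hi
    rw [hg, LinearMap.sub_apply, hb t i hi, Module.algebraMap_end_apply, sub_smul]
    abel
  induction k with
  | zero => simp [Module.End.one_eq_id, b.span_eq]
  | succ k ih =>
    rw [pow_succ', Module.End.mul_eq_comp, LinearMap.range_comp, ih, Submodule.map_span]
    apply le_antisymm
    · rw [Submodule.span_le]
      rintro _ ⟨_, ⟨⟨t, ⟨i, hi⟩⟩, hx, rfl⟩, rfl⟩
      rw [SetLike.mem_coe, hgb t i hi]
      refine add_mem ?_ ?_
      · by_cases ht : μ t = z
        · simp [ht]
        · exact Submodule.smul_mem _ _ (Submodule.subset_span ⟨_, fun h => absurd h ht, rfl⟩)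
      · split_ifs with h
        · exact Submodule.subset_span ⟨⟨t, ⟨i + 1, h⟩⟩, fun ht => Nat.succ_le_succ (hx ht), rfl⟩
        · exact zero_mem _
    · rw [Submodule.span_le]
      rintro _ ⟨⟨t, ⟨i, hi⟩⟩, hx, rfl⟩
      rw [SetLike.mem_coe]
      by_cases ht : μ t = z
      · have hk : k + 1 ≤ i := hx ht
        obtain ⟨i, rfl⟩ := Nat.exists_eq_add_of_le' (le_trans (Nat.le_add_left 1 k) hk)
        refine Submodule.subset_span ⟨_, ⟨⟨t, ⟨i, by omega⟩⟩, fun _ => ?_, rfl⟩, ?_⟩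
        · exact Nat.le_of_succ_le_succ hk
        · rw [hgb t i (by omega), ht, sub_self, zero_smul, zero_add, dif_pos hi]
      -- Induction from the end of the chain: the last vector is a multiple of its image, and each
      -- earlier one is recovered from its image and its successor.
      · obtain ⟨d, hd⟩ := Nat.exists_eq_add_of_lt hi
        clear hx
        induction d generalizing i with
        | zero =>
          have h : b ⟨t, ⟨i, hi⟩⟩ = (μ t - z)⁻¹ • g (b ⟨t, ⟨i, hi⟩⟩) := by
            rw [hgb, dif_neg (by omega), add_zero, inv_smul_smul₀ (sub_ne_zero.2 ht)]
          rw [h]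
          exact Submodule.smul_mem _ _
            (Submodule.subset_span ⟨_, ⟨_, fun h => absurd h ht, rfl⟩, rfl⟩)
        | succ d ihd =>
          have hi' : i + 1 < s t := by omega
          have h : b ⟨t, ⟨i, hi⟩⟩ =
              (μ t - z)⁻¹ • (g (b ⟨t, ⟨i, hi⟩⟩) - b ⟨t, ⟨i + 1, hi'⟩⟩) := by
            rw [hgb, dif_pos hi', add_sub_cancel_right, inv_smul_smul₀ (sub_ne_zero.2 ht)]
          rw [h]
          exact Submodule.smul_mem _ _ (sub_mem
            (Submodule.subset_span ⟨_, ⟨_, fun h => absurd h ht, rfl⟩, rfl⟩)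
            (ihd (i + 1) hi' (by omega)))

open Classical in
/-- The number of Jordan chains of length greater than `k` for the eigenvalue `z`, in terms of
ranks. -/
theorem IsJordanBasis.card_add_finrank {K V ι : Type*} [Field K] [AddCommGroup V] [Module K V]
    [Fintype ι] {s : ι → ℕ} {f : End K V} {μ : ι → K} {b : Basis (Σ t, Fin (s t)) K V}
    (hb : IsJordanBasis f μ b) (z : K) (k : ℕ) :
    (Finset.univ.filter fun t => μ t = z ∧ k < s t).card +
        finrank K (LinearMap.range ((f - algebraMap K (End K V) z) ^ (k + 1))) =
      finrank K (LinearMap.range ((f - algebraMap K (End K V) z) ^ k)) := by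
  have hrank : ∀ k, finrank K (LinearMap.range ((f - algebraMap K (End K V) z) ^ k)) =
      (Finset.univ.filter fun x : Σ t, Fin (s t) => μ x.1 = z → k ≤ (x.2 : ℕ)).card := by
    intro k
    have hli := b.linearIndependent.comp
      (Subtype.val : {x : Σ t, Fin (s t) // μ x.1 = z → k ≤ (x.2 : ℕ)} → _) Subtype.val_injective
    rw [hb.range_pow, ← Fintype.card_subtype, ← finrank_span_eq_card hli, Set.range_comp,
      Subtype.range_coe_subtype]
  -- A chain longer than k is recorded by its vector at position k, counted from 0; these are the
  -- vectors lost from the k-th range to the next.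
  have hcard : (Finset.univ.filter fun t => μ t = z ∧ k < s t).card =
      (Finset.univ.filter fun x : Σ t, Fin (s t) => μ x.1 = z ∧ (x.2 : ℕ) = k).card := by
    refine Finset.card_bij' (fun t ht => ⟨t, ⟨k, (Finset.mem_filter.1 ht).2.2⟩⟩) (fun x _ => x.1)
      ?_ ?_ ?_ ?_
    · intro t ht
      simpa using (Finset.mem_filter.1 ht).2.1
    · rintro ⟨t, i⟩ hx
      obtain ⟨-, h1, h2⟩ := Finset.mem_filter.1 hx
      exact Finset.mem_filter.2 ⟨Finset.mem_univ _, h1, h2 ▸ i.2⟩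
    · intro t ht
      rfl
    · rintro ⟨t, i⟩ hx
      obtain ⟨-, h1, h2⟩ := Finset.mem_filter.1 hx
      simp only at h2
      subst h2
      rfl
  rw [hrank, hrank, hcard, ← Finset.card_union_of_disjoint]
  · congr 1
    ext x
    simp only [Finset.mem_union, Finset.mem_filter, Finset.mem_univ, true_and]
    by_cases h : μ x.1 = z <;> simp [h]
    omega
  · rw [Finset.disjoint_left]
    intro x hx hx'
    have h1 := (Finset.mem_filter.1 hx).2
    have h2 := (Finset.mem_filter.1 hx').2 h1.1
    omega

variable {V : Type*} [AddCommGroup V] [Module ℍ[ℝ] V] [Module ℂ V] [IsScalarTower ℂ ℍ[ℝ] V]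

theorem exists_complexBasis {κ : Type*} [Fintype κ] (b : Basis κ ℍ[ℝ] V) :
    ∃ B : Basis (κ ⊕ κ) ℂ V, (∀ x, B (.inl x) = b x) ∧ ∀ x, B (.inr x) = quatJ • b x := by
  have hsm : ∀ (a c : ℂ) (v : V), a • v + c • quatJ • v =
      ((a : ℍ[ℝ]) + (c : ℍ[ℝ]) * quatJ) • v := fun a c v => by
    rw [add_smul, mul_smul, coeComplex_smul, coeComplex_smul]
  let F : κ ⊕ κ → V := Sum.elim (fun x => b x) fun x => quatJ • b x
  have hli : LinearIndependent ℂ F := by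
    rw [Fintype.linearIndependent_iff]
    intro a ha
    simp only [Fintype.sum_sum_type, F, Sum.elim_inl, Sum.elim_inr, ← Finset.sum_add_distrib,
      hsm] at ha
    have h := Fintype.linearIndependent_iff.1 b.linearIndependent _ ha
    rintro (x | x)
    · have hx := h x
      rw [Quaternion.ext_iff] at hx
      exact Complex.ext (by simpa using hx.1) (by simpa using hx.2.1)
    · have hx := h x
      rw [Quaternion.ext_iff] at hx
      exact Complex.ext (by simpa using hx.2.2.1) (by simpa using hx.2.2.2)
  have hspan : ⊤ ≤ Submodule.span ℂ (Set.range F) := by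
    intro v _
    rw [← b.sum_repr v]
    refine sum_mem fun x _ => ?_
    rw [quaternion_smul_eq, quatJ_smul_complex_smul]
    exact add_mem (Submodule.smul_mem _ _ (Submodule.subset_span ⟨.inl x, rfl⟩))
      (Submodule.smul_mem _ _ (Submodule.subset_span ⟨.inr x, rfl⟩))
  exact ⟨Basis.mk hli hspan, fun x => by rw [Basis.mk_apply]; rfl,
    fun x => by rw [Basis.mk_apply]; rfl⟩

/-- A quaternionic Jordan basis with complex eigenvalues `μ t` gives a complex Jordan basis with
eigenvalues `μ t` and their conjugates. -/
theorem IsJordanBasis.exists_complex {ι : Type*} [Fintype ι] {s : ι → ℕ} {f : End ℍ[ℝ] V}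
    {μ : ι → ℂ} {b : Basis (Σ t, Fin (s t)) ℍ[ℝ] V}
    (hb : IsJordanBasis f (fun t => (μ t : ℍ[ℝ])) b) :
    ∃ B : Basis (Σ t, Fin (Sum.elim s s t)) ℂ V,
      IsJordanBasis (f.restrictScalars ℂ) (Sum.elim μ fun t => starRingEnd ℂ (μ t)) B := by
  obtain ⟨B, hl, hr⟩ := exists_complexBasis b
  let B' : Basis (Σ t, Fin (Sum.elim s s t)) ℂ V :=
    B.reindex (Equiv.sumSigmaDistrib fun t => Fin (Sum.elim s s t)).symm
  have hl' : ∀ t (i : Fin (s t)), B' ⟨.inl t, i⟩ = b ⟨t, i⟩ := fun t i => by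
    rw [← hl]; simp [B', Equiv.sumSigmaDistrib]
  have hr' : ∀ t (i : Fin (s t)), B' ⟨.inr t, i⟩ = quatJ • b ⟨t, i⟩ := fun t i => by
    rw [← hr]; simp [B', Equiv.sumSigmaDistrib]
  refine ⟨B', ?_⟩
  rintro (t | t) i hi
  · change f (B' ⟨.inl t, (⟨i, hi⟩ : Fin (s t))⟩) = μ t • B' ⟨.inl t, (⟨i, hi⟩ : Fin (s t))⟩ +
      if h : i + 1 < s t then B' ⟨.inl t, (⟨i + 1, h⟩ : Fin (s t))⟩ else 0
    simp only [hl']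
    rw [hb t i hi, coeComplex_smul]
  · change f (B' ⟨.inr t, (⟨i, hi⟩ : Fin (s t))⟩) =
      (starRingEnd ℂ (μ t)) • B' ⟨.inr t, (⟨i, hi⟩ : Fin (s t))⟩ +
      if h : i + 1 < s t then B' ⟨.inr t, (⟨i + 1, h⟩ : Fin (s t))⟩ else 0
    simp only [hr']
    rw [map_smul, hb t i hi, coeComplex_smul, smul_add, quatJ_smul_complex_smul]
    split_ifs <;> simp

-- For real z a chain and its conjugate both count, giving the factor 2; for Im z > 0 the conjugate
-- eigenvalues lie in the lower half plane and contribute nothing.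
open Classical in
theorem card_filter_sumElim_conj {ι : Type*} [Fintype ι] {s : ι → ℕ} {μ : ι → ℂ}
    (hμ : ∀ t, 0 ≤ (μ t).im) {z : ℂ} (hz : 0 ≤ z.im) (k : ℕ) :
    (Finset.univ.filter fun t : ι ⊕ ι =>
      (Sum.elim μ fun t => starRingEnd ℂ (μ t)) t = z ∧ k < Sum.elim s s t).card =
    (if z.im = 0 then 2 else 1) * (Finset.univ.filter fun t => μ t = z ∧ k < s t).card := by
  rw [← Fintype.card_subtype, Fintype.card_congr (Equiv.subtypeSum), Fintype.card_sum,
    Fintype.card_subtype, Fintype.card_subtype]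
  simp only [Sum.elim_inl, Sum.elim_inr]
  split_ifs with h
  · have : ∀ t, starRingEnd ℂ (μ t) = z ↔ μ t = z := fun t => by
      rw [← Complex.conj_eq_iff_im.2 h, (starRingEnd ℂ).injective.eq_iff,
        Complex.conj_eq_iff_im.2 h]
    simp only [this, two_mul]
    congr!
  · have : ∀ t, starRingEnd ℂ (μ t) ≠ z := by
      rintro t rfl
      have := hμ t
      simp only [Complex.conj_im] at hz h
      exact h (by linarith)
    simp only [this, false_and, Finset.filter_false, Finset.card_empty, add_zero, one_mul]
    congr!

theorem card_filter_lt_eq_add {ι α : Type*} [Fintype ι] [DecidableEq α] (s : ι → ℕ) (μ : ι → α)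
    (z : α) (k : ℕ) :
    (Finset.univ.filter fun t => μ t = z ∧ k < s t).card =
      (Finset.univ.filter fun t => (s t, μ t) = (k + 1, z)).card +
      (Finset.univ.filter fun t => μ t = z ∧ k + 1 < s t).card := by
  classical
  rw [← Finset.card_union_of_disjoint]
  · congr 1
    ext t
    simp only [Finset.mem_union, Finset.mem_filter, Finset.mem_univ, true_and, Prod.mk.injEq]
    by_cases h : μ t = z <;> simp [h]
    omega
  · rw [Finset.disjoint_left]
    intro t ht ht'
    simp only [Finset.mem_filter, Finset.mem_univ, true_and, Prod.mk.injEq] at ht ht'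
    omega

/-- The number of chains of length exactly k + 1 is a difference of consecutive counts, so all
fibres of (length, eigenvalue) have equal size. Positivity of the lengths disposes of length 0. -/
theorem exists_equiv_of_card_filter_eq {ι ι' α : Type*} [Fintype ι] [Fintype ι'] [DecidableEq α]
    {s : ι → ℕ} {s' : ι' → ℕ} {μ : ι → α} {μ' : ι' → α} (hs : ∀ t, 0 < s t) (hs' : ∀ t, 0 < s' t)
    (h : ∀ z k, (Finset.univ.filter fun t => μ t = z ∧ k < s t).card =
      (Finset.univ.filter fun t => μ' t = z ∧ k < s' t).card) :
    ∃ e : ι ≃ ι', ∀ t, s' (e t) = s t ∧ μ' (e t) = μ t := by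
  have hfib : ∀ c : ℕ × α, Fintype.card {t // (s t, μ t) = c} =
      Fintype.card {t // (s' t, μ' t) = c} := by
    rintro ⟨k, z⟩
    rw [Fintype.card_subtype, Fintype.card_subtype]
    cases k with
    | zero =>
      rw [Finset.filter_false_of_mem fun t _ => by simp [(hs t).ne'],
        Finset.filter_false_of_mem fun t _ => by simp [(hs' t).ne']]
      simp
    | succ k =>
      have h1 := h z k
      rw [card_filter_lt_eq_add s, card_filter_lt_eq_add s', h z (k + 1)] at h1
      exact Nat.add_right_cancel h1
  refine ⟨Equiv.ofFiberEquiv fun c => Fintype.equivOfCardEq (hfib c), fun t => ?_⟩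
  exact Prod.mk.inj (Equiv.ofFiberEquiv_map (f := fun t => (s t, μ t))
    (g := fun t => (s' t, μ' t)) _ t)

/-- The chain lengths and the eigenvalues in the closed upper half plane of a quaternionic Jordan
basis are unique up to permutation. -/
theorem IsJordanBasis.exists_equiv {ι ι' : Type*} [Fintype ι] [Fintype ι'] {s : ι → ℕ}
    {s' : ι' → ℕ} {f : End ℍ[ℝ] V} {μ : ι → ℂ} {μ' : ι' → ℂ} {b : Basis (Σ t, Fin (s t)) ℍ[ℝ] V}
    {b' : Basis (Σ t, Fin (s' t)) ℍ[ℝ] V} (hs : ∀ t, 0 < s t) (hs' : ∀ t, 0 < s' t)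
    (hμ : ∀ t, 0 ≤ (μ t).im) (hμ' : ∀ t, 0 ≤ (μ' t).im)
    (hb : IsJordanBasis f (fun t => (μ t : ℍ[ℝ])) b)
    (hb' : IsJordanBasis f (fun t => (μ' t : ℍ[ℝ])) b') :
    ∃ e : ι ≃ ι', ∀ t, s' (e t) = s t ∧ μ' (e t) = μ t := by
  classical
  obtain ⟨B, hB⟩ := hb.exists_complex
  obtain ⟨B', hB'⟩ := hb'.exists_complex
  refine exists_equiv_of_card_filter_eq hs hs' fun z k => ?_
  rcases le_or_gt 0 z.im with hz | hz
  · have h := Nat.add_right_cancel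
      ((hB.card_add_finrank z k).trans (hB'.card_add_finrank z k).symm)
    rw [card_filter_sumElim_conj hμ hz, card_filter_sumElim_conj hμ' hz] at h
    convert Nat.eq_of_mul_eq_mul_left (by split_ifs <;> norm_num) h
  · rw [Finset.filter_false_of_mem, Finset.filter_false_of_mem]
    · simp
    · rintro t - ⟨rfl, -⟩
      exact (hμ' t).not_gt hz
    · rintro t - ⟨rfl, -⟩
      exact (hμ t).not_gt hz

end Counting

/-! ### From consimilarity of matrices to Jordan bases -/

section Matrices

theorem Quaternion.coeComplex_ne_zero {z : ℂ} (hz : z ≠ 0) : (z : ℍ[ℝ]) ≠ 0 :=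
  (map_ne_zero Quaternion.ofComplex).2 hz

theorem Quaternion.coeComplex_pow (z : ℂ) (k : ℕ) : ((z ^ k : ℂ) : ℍ[ℝ]) = (z : ℍ[ℝ]) ^ k :=
  map_pow Quaternion.ofComplex z k

/-- Multiplying the vectors of a basis by nonzero scalars. -/
theorem exists_basis_smul {κ K V : Type*} [DivisionRing K] [AddCommGroup V] [Module K V]
    (b : Basis κ K V) {w : κ → K} (hw : ∀ x, w x ≠ 0) :
    ∃ B : Basis κ K V, ∀ x, B x = w x • b x :=
  ⟨b.unitsSMul fun x => Units.mk0 _ (hw x), fun x => by rw [Basis.unitsSMul_apply]; rfl⟩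

theorem sigmaConsimilar_iff {n : ℕ} {σ : ℍ[ℝ]} (hσ : σ ≠ 0) (A B : Matrix (Fin n) (Fin n) ℍ[ℝ]) :
    SigmaConsimilar σ A B ↔ ∃ S : (Matrix (Fin n) (Fin n) ℍ[ℝ])ˣ,
      (S⁻¹ : (Matrix (Fin n) (Fin n) ℍ[ℝ])ˣ).1 * (σ • A) = (σ • B) * (S⁻¹).1 := by
  have key : ∀ S : (Matrix (Fin n) (Fin n) ℍ[ℝ])ˣ,
      σ • (conjBy σ S⁻¹.1 * A) = S⁻¹.1 * (σ • A) := by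
    intro S
    refine Matrix.ext fun r c => ?_
    simp only [conjBy, Matrix.smul_apply, Matrix.mul_apply, Matrix.map_apply, smul_eq_mul,
      Finset.mul_sum, mul_assoc, mul_inv_cancel_left₀ hσ]
  refine exists_congr fun S => ?_
  rw [← key, ← Units.mul_inv_eq_iff_eq_mul, inv_inv, Matrix.smul_mul]
  exact (smul_right_injective _ hσ).eq_iff.symm

/-- Right multiplication of row vectors by a matrix is linear over the left scalars. A matrix is
invertible exactly when its rows form a basis; here the rows of `S⁻¹` will be the Jordan basis. -/
theorem exists_units_iff_exists_basis {n : ℕ} {κ R : Type*} [Ring R] [Fintype κ] (e : κ ≃ Fin n)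
    (P : Matrix (Fin n) (Fin n) R → Prop) :
    (∃ S : (Matrix (Fin n) (Fin n) R)ˣ, P (S⁻¹).1) ↔
      ∃ b : Basis κ R (Fin n → R), P (Matrix.of fun r => b (e.symm r)) := by
  constructor
  · rintro ⟨S, hS⟩
    refine ⟨((Pi.basisFun R (Fin n)).map
      (Matrix.toLinearEquivRight'OfInv S.mul_inv S.inv_mul)).reindex e.symm, ?_⟩
    convert hS
    refine Matrix.ext fun r c => ?_
    simp
  · rintro ⟨b, hb⟩
    let φ : (Fin n → R) ≃ₗ[R] (Fin n → R) := (Pi.basisFun R (Fin n)).equiv b e.symm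
    refine ⟨⟨LinearMap.toMatrixRight' φ.symm.toLinearMap, LinearMap.toMatrixRight' φ.toLinearMap,
      ?_, ?_⟩, ?_⟩
    · rw [← LinearMap.toMatrixRight'_comp]; simp
    · rw [← LinearMap.toMatrixRight'_comp]; simp
    · convert hb
      refine Matrix.ext fun r c => ?_
      have : φ (Pi.single r 1) = b (e.symm r) := by
        simpa using (Pi.basisFun R (Fin n)).equiv_apply r b e.symm
      exact congrFun this c

theorem jordanBlock_smul_sum {k : ℕ} (z : ℂ) {V : Type*} [AddCommGroup V] [Module ℍ[ℝ] V]
    (w : Fin k → V) (i : ℕ) (hi : i < k) :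
    ∑ c, (jordanBlock k z ⟨i, hi⟩ c : ℍ[ℝ]) • w c =
      (z : ℍ[ℝ]) • w ⟨i, hi⟩ + if h : i + 1 < k then w ⟨i + 1, h⟩ else 0 := by
  have h1 : ∀ c, (jordanBlock k z ⟨i, hi⟩ c : ℍ[ℝ]) • w c =
      (if ⟨i, hi⟩ = c then (z : ℍ[ℝ]) • w c else 0) + if i + 1 = (c : ℕ) then w c else 0 := by
    intro c
    by_cases h : (⟨i, hi⟩ : Fin k) = c
    · subst h
      simp [jordanBlock]
    · by_cases h' : i + 1 = (c : ℕ) <;> simp [jordanBlock, h, h']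
  simp only [h1, Finset.sum_add_distrib, Finset.sum_ite_eq, Finset.mem_univ, if_true]
  congr 1
  split_ifs with h
  · rw [Finset.sum_eq_single ⟨i + 1, h⟩]
    · simp
    · intro c _ hc
      exact if_neg fun h' => hc (Fin.ext h'.symm)
    · simp
  · exact Finset.sum_eq_zero fun c _ => if_neg fun h' => h (lt_of_eq_of_lt h' c.2)

/-- `A` is consimilar to a complex Jordan matrix if and only if right multiplication of row vectors
by `z • A` has a corresponding Jordan basis. -/
theorem sigmaConsimilar_toMatrix_iff {n : ℕ} {z : ℂ} (hz : z ≠ 0)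
    (A : Matrix (Fin n) (Fin n) ℍ[ℝ]) (J : JordanData n) :
    SigmaConsimilar (z : ℍ[ℝ]) A (J.toMatrix.map Quaternion.coeComplex) ↔
      ∃ b : Basis (Σ t, Fin (J.size t)) ℍ[ℝ] (Fin n → ℍ[ℝ]),
        IsJordanBasis (Matrix.toLinearMapRight' ((z : ℍ[ℝ]) • A))
          (fun t => ((z * J.eig t : ℂ) : ℍ[ℝ])) b := by
  have hzq := Quaternion.coeComplex_ne_zero hz
  set σ : ℍ[ℝ] := (z : ℍ[ℝ]) with hσ
  let e : (Σ t, Fin (J.size t)) ≃ Fin n := finSigmaFinEquiv.trans (finCongr J.sum_size)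
  have hrow : ∀ (b : Basis (Σ t, Fin (J.size t)) ℍ[ℝ] (Fin n → ℍ[ℝ])),
      (Matrix.of (fun r => b (e.symm r)) * (σ • A) =
        (σ • J.toMatrix.map Quaternion.coeComplex) * Matrix.of (fun r => b (e.symm r))) ↔
      ∀ t (i : ℕ) (hi : i < J.size t), Matrix.toLinearMapRight' (σ • A) (b ⟨t, ⟨i, hi⟩⟩) =
        σ • ((J.eig t : ℍ[ℝ]) • b ⟨t, ⟨i, hi⟩⟩ +
          if h : i + 1 < J.size t then b ⟨t, ⟨i + 1, h⟩⟩ else 0) := by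
    intro b
    have hr : ∀ t (i : Fin (J.size t)),
        ((σ • J.toMatrix.map Quaternion.coeComplex) * Matrix.of (fun r => b (e.symm r))) (e ⟨t, i⟩) =
        σ • ∑ c, (jordanBlock (J.size t) (J.eig t) i c : ℍ[ℝ]) • b ⟨t, c⟩ := by
      intro t i
      rw [Matrix.smul_mul]
      change σ • ((J.toMatrix.map Quaternion.coeComplex *
        Matrix.of (fun r => b (e.symm r))) (e ⟨t, i⟩)) = _
      congr 1
      refine funext fun c => ?_
      rw [Matrix.mul_apply, ← e.sum_comp, Fintype.sum_sigma, Finset.sum_eq_single t]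
      · simp [JordanData.toMatrix, e, Matrix.blockDiagonal'_apply]
      · intro t' _ ht'
        refine Finset.sum_eq_zero fun c' _ => ?_
        simp [JordanData.toMatrix, e, Matrix.blockDiagonal'_apply, ht'.symm]
      · simp
    have hrows : ∀ M N : Matrix (Fin n) (Fin n) ℍ[ℝ], M = N ↔ ∀ r, M r = N r :=
      fun _ _ => funext_iff
    rw [hrows, ← e.forall_congr_right, Sigma.forall]
    refine forall_congr' fun t => Fin.forall_iff.trans <| forall₂_congr fun i hi => ?_
    rw [hr, jordanBlock_smul_sum]
    have : (Matrix.of (fun r => b (e.symm r)) * (σ • A)) (e ⟨t, ⟨i, hi⟩⟩) =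
        Matrix.toLinearMapRight' (σ • A) (b ⟨t, ⟨i, hi⟩⟩) := by
      rw [Matrix.mul_apply_eq_vecMul, ← e.symm_apply_apply ⟨t, ⟨i, hi⟩⟩]
      simp only [Equiv.apply_symm_apply]
      rfl
    rw [this]
  rw [sigmaConsimilar_iff hzq, exists_units_iff_exists_basis e (P := fun T =>
    T * (σ • A) = (σ • J.toMatrix.map Quaternion.coeComplex) * T)]
  simp only [hrow]
  constructor
  · rintro ⟨b, hb⟩
    -- The power σ^i absorbs the factor σ in front of the next chain vector and leaves it on the
    -- eigenvalue.
    obtain ⟨B, hB⟩ := exists_basis_smul b (w := fun x => σ ^ (x.2 : ℕ)) fun x => pow_ne_zero _ hzq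
    refine ⟨B, fun t i hi => ?_⟩
    rw [hB, map_smul, hb, smul_smul, ← pow_succ, smul_add, smul_smul, smul_smul]
    congr 1
    · rw [hσ, ← Quaternion.coeComplex_pow, ← Quaternion.coeComplex_pow,
        ← Quaternion.coeComplex_mul, ← Quaternion.coeComplex_mul]
      congr 2
      ring
    · split_ifs
      · rw [hB]
      · simp
  · rintro ⟨b, hb⟩
    obtain ⟨B, hB⟩ := exists_basis_smul b (w := fun x => (σ ^ (x.2 : ℕ))⁻¹)
      fun x => inv_ne_zero (pow_ne_zero _ hzq)
    refine ⟨B, fun t i hi => ?_⟩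
    rw [hB, map_smul, hb, smul_add, smul_add, smul_smul, smul_smul, smul_smul]
    congr 1
    · have : ∀ k, (σ ^ k)⁻¹ = (((z ^ k)⁻¹ : ℂ) : ℍ[ℝ]) := fun k => by
        rw [hσ, ← Quaternion.coeComplex_pow]
        exact (map_inv₀ Quaternion.ofComplex _).symm
      simp only [this]
      rw [hσ, ← Quaternion.coeComplex_mul, ← Quaternion.coeComplex_mul,
        ← Quaternion.coeComplex_mul]
      congr 2
      ring
    · split_ifs
      · rw [hB, smul_smul]
        congr 1
        change (σ ^ i)⁻¹ = σ * (σ ^ (i + 1))⁻¹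
        rw [pow_succ, mul_inv_rev, mul_inv_cancel_left₀ hzq]
      · simp

/-- Both normalizations say that `z * eig t` lies in the closed upper half plane, where `z` is
`1` or `i`. -/
theorem exists_complex_of_eq_one_or_eq_quatI {σ : ℍ[ℝ]} (hσ : σ = 1 ∨ σ = quatI) :
    ∃ z : ℂ, z ≠ 0 ∧ σ = z ∧
      ∀ {n : ℕ} (J : JordanData n), J.Normalized σ ↔ ∀ t, 0 ≤ (z * J.eig t).im := by
  have hne : (1 : ℍ[ℝ]) ≠ quatI := fun h => by
    simpa [quatI] using (Quaternion.ext_iff.1 h).1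
  rcases hσ with rfl | rfl
  · exact ⟨1, one_ne_zero, by simp, fun J => by simp [JordanData.Normalized, hne]⟩
  · exact ⟨Complex.I, Complex.I_ne_zero, rfl, fun J => by simp [JordanData.Normalized, hne.symm]⟩

end Matrices

/-! ### The canonical form -/

theorem theorem2p1 (σ : ℍ[ℝ]) (hσ : σ = 1 ∨ σ = quatI) (n : ℕ)
    (A : Matrix (Fin n) (Fin n) ℍ[ℝ]) :
    (∃ J : JordanData n, IsCanonicalForm σ A J) ∧
      (∀ J J' : JordanData n, IsCanonicalForm σ A J → IsCanonicalForm σ A J' →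
        J.IsPermOf J') := by
  obtain ⟨z, hz, rfl, hnorm⟩ := exists_complex_of_eq_one_or_eq_quatI hσ
  constructor
  · obtain ⟨ι, _, s, μ, b, hs, hμ, hb⟩ :=
      hasJordanBasis_quaternion (Matrix.toLinearMapRight' ((z : ℍ[ℝ]) • A))
    choose ν hν hνμ using hμ
    let ε := Fintype.equivFin ι
    let J : JordanData n :=
      { m := Fintype.card ι
        size := fun t => s (ε.symm t)
        -- The chains belong to zA, so their eigenvalues are z times those of the blocks.
        eig := fun t => z⁻¹ * ν (ε.symm t)
        size_pos := fun t => hs _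
        sum_size := by
          rw [ε.symm.sum_comp s]
          have := finrank_eq_card_basis b
          simpa using this.symm }
    have hJ : ∀ t, z * J.eig t = ν (ε.symm t) := fun t => mul_inv_cancel_left₀ hz _
    refine ⟨J, (hnorm J).2 fun t => hJ t ▸ hν _, (sigmaConsimilar_toMatrix_iff hz A J).2
      ⟨b.reindex (Equiv.sigmaCongrLeft ε.symm (β := fun t => Fin (s t))).symm, ?_⟩⟩
    intro t i hi
    have h := hb (ε.symm t) i hi
    rw [← hνμ, ← hJ] at h
    simpa [Equiv.sigmaCongrLeft] using h
  · rintro J J' ⟨hJ, hAJ⟩ ⟨hJ', hAJ'⟩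
    obtain ⟨b, hb⟩ := (sigmaConsimilar_toMatrix_iff hz A J).1 hAJ
    obtain ⟨b', hb'⟩ := (sigmaConsimilar_toMatrix_iff hz A J').1 hAJ'
    obtain ⟨e, he⟩ := hb.exists_equiv J.size_pos J'.size_pos ((hnorm J).1 hJ) ((hnorm J').1 hJ') hb'
    exact ⟨e, fun t => ⟨(he t).1, mul_left_cancel₀ hz (he t).2⟩⟩
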